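/- A \emph{convex set} is a set $X$ with binary operations $+_r\colon X\times X\to X$ ($r\in[0,1]$) satisfying $x+_r x=x$, $x+_0y=y$, $x+_ry=y+_{1-r}x$, and $x+_r(y+_sz)=(x+_{r'}y)+_{s'}z$ whenever $s'=r+s-rs\neq 0$ and $r'=r/s'$. A map between convex sets is \emph{affine} if it preserves all operations $+_r$. For a set $G$, the set $\mathcal{D}G$ of finitely supported probability distributions on $G$ is a convex set with $(d+_re)(g)=r\,d(g)+(1-r)\,e(g)$. A convex set $X$ is \emph{finitely generated} if there is an affine surjection $\mathcal{D}G\to X$ for some finite set $G$. A \emph{convex monoid} is a convex set $M$ with a monoid structure $(M,\cdot,e)$ such that $(m+_rm')\cdot n=m\cdot n+_rm'\cdot n$ and $m\cdot(n+_rn')=m\cdot n+_rm\cdot n'$ for all $m,m',n,n'\in M$ and $r\in[0,1]$. For a set $G$, let $T G$ be the algebra of terms over the signature $\{e,\cdot\}\cup\{+_r : r\in[0,1]\}$ with variables from $G$; a \emph{morphism} is a map preserving all operations of this signature. A convex monoid $M$ is \emph{finitely presentable} if there are a finite set $G$, a finite set $R\subseteq TG\times TG$, and a surjective morphism $q\colon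 TG\to M$ with $q(s)=q(t)$ for all $(s,t)\in R$, such that every morphism $h\colon TG\to B$ into a convex monoid $B$ with $h(s)=h(t)$ for all $(s,t)\in R$ factorizes as $h=k\circ q$ for some morphism $k\colon M\to B$. \textbf{Theorem.} Every convex monoid whose underlying convex set is finitely generated is finitely presentable (as a convex monoid). -/

import Mathlib

/-- A type with a family of binary operations `x +_r y`, one for each `r ∈ [0,1]`;
`mix r x y` is `x +_r y` (weight `r` on `x`, weight `1 - r` on `y`). -/
class HasMix (X : Type*) where
  mix : unitInterval → X → X → X

section

open HasMix (mix)

/-- Convex sets in the sense of Stone (abstract convex sets). -/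
class ConvexSet (X : Type*) extends HasMix X where
  /-- `x +_r x = x`. -/
  mix_self : ∀ (r : unitInterval) (x : X), mix r x x = x
  /-- `x +_0 y = y`. -/
  mix_zero : ∀ x y : X, mix 0 x y = y
  /-- `x +_r y = y +_{1-r} x`. -/
  mix_comm : ∀ (r : unitInterval) (x y : X), mix r x y = mix (unitInterval.symm r) y x
  /-- `x +_r (y +_s z) = (x +_{r'} y) +_{s'} z`, where `s' = r + s - rs ≠ 0` and `r' = r / s'`. -/
  mix_assoc : ∀ (r s r' s' : unitInterval) (x y z : X),
    (s' : ℝ) = r + s - r * s → (s' : ℝ) ≠ 0 → (r' : ℝ) = r / s' →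
      mix r x (mix s y z) = mix s' (mix r' x y) z

/-- Affine maps: those which preserve all the operations `+_r`. -/
def IsAffine {X Y : Type*} [HasMix X] [HasMix Y] (f : X → Y) : Prop :=
  ∀ (r : unitInterval) (x x' : X), f (mix r x x') = mix r (f x) (f x')

/-- Convex monoids: convex sets with a monoid structure whose multiplication is affine in each
argument separately. -/
class ConvexMonoid (M : Type*) extends ConvexSet M, Monoid M where
  mix_mul : ∀ (r : unitInterval) (m m' n : M), mix r m m' * n = mix r (m * n) (m' * n)
  mul_mix : ∀ (r : unitInterval) (m n n' : M), m * mix r n n' = mix r (m * n) (m * n')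

/-- The finitely supported probability distributions on `G` (the set `𝒟 G`) with the pointwise
operations `(d +_r e)(g) = r * d g + (1 - r) * e g`. -/
noncomputable instance (G : Type*) : HasMix (Convexity.StdSimplex ℝ G) where
  mix r d e :=
    Convexity.convexCombPair (r : ℝ) (1 - r) r.2.1 (sub_nonneg.2 r.2.2) (add_sub_cancel _ _) d e

theorem StdSimplex_mix_weights {G : Type*} (r : unitInterval) (d e : Convexity.StdSimplex ℝ G)
    (g : G) : (mix r d e).weights g = r * d.weights g + (1 - r) * e.weights g := by
  simp [mix]

noncomputable instance (G : Type*) : ConvexSet (Convexity.StdSimplex ℝ G) where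
  mix_self r x := by
    ext g; simp only [StdSimplex_mix_weights]; ring
  mix_zero x y := by
    ext g; simp [StdSimplex_mix_weights]
  mix_comm r x y := by
    ext g; simp only [StdSimplex_mix_weights, unitInterval.coe_symm_eq]; ring
  mix_assoc r s r' s' x y z hs' h0 hr' := by
    ext g
    simp only [StdSimplex_mix_weights]
    have h : (s' : ℝ) * r' = r := by rw [hr']; field_simp
    linear_combination (y.weights g - x.weights g) * h + (z.weights g - y.weights g) * hs'

/-- A convex set `X` is finitely generated if there is an affine surjection `𝒟 G → X` for some
finite set `G`. -/
def ConvexSet.IsFinitelyGenerated (X : Type*) [ConvexSet X] : Prop :=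
  ∃ (G : Type) (_ : Finite G) (s : Convexity.StdSimplex ℝ G → X),
    IsAffine s ∧ Function.Surjective s

/-- A convex monoid is fg-carried if its underlying convex set is finitely generated. -/
def ConvexMonoid.IsFgCarried (M : Type*) [ConvexMonoid M] : Prop :=
  ConvexSet.IsFinitelyGenerated M

end

namespace ConvexMonoid

/-- Terms over the signature of convex monoids (a constant `e`, a binary operation `·`, and a
binary operation `+_r` for each `r ∈ [0,1]`) with variables from `G`. -/
inductive Term (G : Type*) where
  | var : G → Term G
  | one : Term G
  | mul : Term G → Term G → Term G
  | mix : unitInterval → Term G → Term G → Term G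

instance (G : Type*) : One (Term G) := ⟨Term.one⟩

instance (G : Type*) : Mul (Term G) := ⟨Term.mul⟩

instance (G : Type*) : HasMix (Term G) := ⟨Term.mix⟩

/-- Morphisms of algebras over the signature of convex monoids. Between convex monoids these are
the affine monoid morphisms. -/
structure IsMorphism {A B : Type*} [One A] [Mul A] [HasMix A] [One B] [Mul B] [HasMix B]
    (f : A → B) : Prop where
  map_one : f 1 = 1
  map_mul : ∀ x y : A, f (x * y) = f x * f y
  map_mix : ∀ (r : unitInterval) (x y : A), f (HasMix.mix r x y) = HasMix.mix r (f x) (f y)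

/-- `(G, R, q)` is a finite presentation of the convex monoid `M`: `G` is a finite set of
generators, `R` is a finite set of relations `s = t` between terms over `G`, and `q` is a
surjective morphism from the term algebra that satisfies the relations and through which every
morphism from the term algebra to a convex monoid satisfying the relations factorizes. -/
structure IsFinitePresentation.{w, v, u} {M : Type u} [ConvexMonoid M] (G : Type w)
    (R : Set (Term G × Term G)) (q : Term G → M) : Prop where
  finite_generators : Finite G
  finite_relations : R.Finite
  isMorphism : IsMorphism q
  surjective : Function.Surjective q
  relations : ∀ p ∈ R, q p.1 = q p.2
  factorization : ∀ (B : Type v) [ConvexMonoid B] (h : Term G → B), IsMorphism h →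
    (∀ p ∈ R, h p.1 = h p.2) → ∃ k : M → B, IsMorphism k ∧ h = k ∘ q

/-- A convex monoid is finitely presentable if it has a finite presentation. The universe `v` is
that of the convex monoids in the universal property. -/
def IsFinitelyPresentable.{v, u} (M : Type u) [ConvexMonoid M] : Prop :=
  ∃ (G : Type) (R : Set (Term G × Term G)) (q : Term G → M),
    IsFinitePresentation.{0, v, u} G R q

end ConvexMonoid

universe u v

/-! Two facts combine. First, a finitely generated convex set is finitely presented. It embeds in
its cone, an `ℝ≥0`-module, so it suffices that the kernel congruence of a linear map on `ℝ≥0 ^ G` is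
finitely generated (`exists_finite_generating_kernel`). There, pairs with equal support are governed
by finite-dimensional real linear algebra plus a limited cancellation law. Finitely many further
pairs adjust supports. Preservation of total weight turns the resulting relations into equations of
convex terms (`ConvexTerm.exists_finite_relations`). Second, multiplication is biaffine, so it is
determined by the products of generators. Adding one relation for the unit and one for each product
of two generators reduces every term to a convex term (`exists_convexTerm`), where the convex
relations decide equality. -/

open scoped NNReal

/-! ### Partial cancellation in `ℝ≥0`-modules. -/

section NNRealModule

variable {D : Type*} [AddCommMonoid D] [Module ℝ≥0 D]

/-- Exchanging `x` for `y` twice in the presence of `u` gives `2x + u = 2y + u`; then halve. -/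
theorem add_half_smul_cancel {x y u : D} (h : x + u = y + u) :
    x + (1 / 2 : ℝ≥0) • u = y + (1 / 2 : ℝ≥0) • u := by
  have h2 : x + x + u = y + y + u := by
    rw [add_assoc, h, ← add_assoc, add_comm x y, add_assoc, h, add_assoc]
  have h3 := congrArg (fun z => (1 / 2 : ℝ≥0) • z) h2
  have e : ∀ z : D, (1 / 2 : ℝ≥0) • (z + z) = z := fun z => by
    rw [smul_add, ← add_smul, add_halves, one_smul]
  simpa only [smul_add _ (_ + _) u, e] using h3

theorem add_half_pow_smul_cancel {x y u : D} (h : x + u = y + u) (n : ℕ) :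
    x + ((1 / 2 : ℝ≥0) ^ n) • u = y + ((1 / 2 : ℝ≥0) ^ n) • u := by
  induction n with
  | zero => simpa using h
  | succ n ih => simpa only [smul_smul, ← pow_succ'] using add_half_smul_cancel ih

theorem add_smul_cancel {x y u : D} (h : x + u = y + u) {ε : ℝ≥0} (hε : 0 < ε) :
    x + ε • u = y + ε • u := by
  obtain ⟨n, hn⟩ := exists_pow_lt_of_lt_one hε (by norm_num : (1 / 2 : ℝ≥0) < 1)
  have h1 := congrArg (· + (ε - (1 / 2 : ℝ≥0) ^ n) • u) (add_half_pow_smul_cancel h n)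
  simpa only [add_assoc, ← add_smul, add_tsub_cancel_of_le hn.le] using h1

/-- A summand can be cancelled when both sides already contain a positive multiple of it, since
`add_smul_cancel` shrinks it to any positive size. -/
theorem eq_of_add_eq_add_of_absorbs {x y x' y' u : D} {ε : ℝ≥0} (hε : 0 < ε)
    (hx : x = x' + ε • u) (hy : y = y' + ε • u) (h : x + u = y + u) : x = y := by
  rw [hx, hy] at h ⊢
  refine add_smul_cancel (x := x') (y := y') ?_ hε
  have h1 : x' + (ε + 1) • u = y' + (ε + 1) • u := by
    simpa only [add_smul, one_smul, add_assoc] using h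
  -- The factor is chosen to shrink `(ε + 1) • u` to `u`.
  have h2 := add_smul_cancel h1 (ε := (ε + 1)⁻¹) (by positivity)
  rwa [smul_smul, inv_mul_cancel₀ (by positivity), one_smul] at h2

end NNRealModule

/-! ### Finite generation of kernel congruences. -/

section Kernel

open Function (support)

variable {G : Type*}

theorem exists_pos_add_smul_of_support_subset [Finite G] {x u : G → ℝ≥0} (h : support u ⊆ support x) :
    ∃ ε : ℝ≥0, 0 < ε ∧ ∀ δ ≤ ε, ∃ x', x = x' + δ • u := by
  have h1 : ∀ g, ∃ ε : ℝ≥0, 0 < ε ∧ ε * u g ≤ x g := by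
    intro g
    by_cases hu : u g = 0
    · exact ⟨1, one_pos, by simp [hu]⟩
    · exact ⟨x g / u g, div_pos (pos_iff_ne_zero.2 (h hu)) (pos_iff_ne_zero.2 hu),
        (div_mul_cancel₀ _ hu).le⟩
  choose e he hle using h1
  obtain ⟨ε, hε, hε'⟩ : ∃ ε : ℝ≥0, 0 < ε ∧ ∀ g, ε ≤ e g := by
    cases nonempty_fintype G
    cases isEmpty_or_nonempty G
    · exact ⟨1, one_pos, isEmptyElim⟩
    · exact ⟨Finset.univ.inf' Finset.univ_nonempty e, by simpa using he,
        fun g => Finset.inf'_le _ (Finset.mem_univ g)⟩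
  refine ⟨ε, hε, fun δ hδ => ⟨x - δ • u, (tsub_add_cancel_of_le fun g => ?_).symm⟩⟩
  exact (mul_le_mul_left (hδ.trans (hε' g)) (u g)).trans (hle g)

/-- The real vector of differences of a pair of vectors of nonnegative reals. -/
def realDiff (p : (G → ℝ≥0) × (G → ℝ≥0)) : G → ℝ := fun g => (p.1 g : ℝ) - p.2 g

/-- Pairs identified by `ψ` are closed under sums, nonnegative multiples and swapping, and a swap
negates the difference; hence real combinations of differences are again such differences. -/
theorem exists_balanced_of_mem_span {D : Type*} [AddCommMonoid D] [Module ℝ≥0 D]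
    (ψ : (G → ℝ≥0) →ₗ[ℝ≥0] D) {H : Set G} {R : Set ((G → ℝ≥0) × (G → ℝ≥0))}
    (hR : ∀ p ∈ R, support p.1 ⊆ H ∧ support p.2 ⊆ H) (hψ : ∀ p ∈ R, ψ p.1 = ψ p.2)
    {z : G → ℝ} (hz : z ∈ Submodule.span ℝ (realDiff '' R)) :
    ∃ p, support p.1 ⊆ H ∧ support p.2 ⊆ H ∧ ψ p.1 = ψ p.2 ∧ realDiff p = z := by
  induction hz using Submodule.span_induction with
  | mem z hz =>
    obtain ⟨p, hp, rfl⟩ := hz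
    exact ⟨p, (hR p hp).1, (hR p hp).2, hψ p hp, rfl⟩
  | zero => exact ⟨0, by simp, by simp, rfl, by ext; simp [realDiff]⟩
  | add z w _ _ hz hw =>
    obtain ⟨p, h1, h2, h3, rfl⟩ := hz
    obtain ⟨p', h1', h2', h3', rfl⟩ := hw
    refine ⟨p + p', (Function.support_add _ _).trans (Set.union_subset h1 h1'),
      (Function.support_add _ _).trans (Set.union_subset h2 h2'), by simp [h3, h3'], ?_⟩
    ext g; simp [realDiff]; ring
  | smul c z _ hz =>
    obtain ⟨p, h1, h2, h3, rfl⟩ := hz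
    rcases le_total 0 c with hc | hc
    · lift c to ℝ≥0 using hc
      refine ⟨c • p, (Function.support_const_smul_subset _ _).trans h1,
        (Function.support_const_smul_subset _ _).trans h2, by simp [h3], ?_⟩
      ext g; simp [realDiff]; ring
    · obtain ⟨d, hd⟩ : ∃ d : ℝ≥0, c = -(d : ℝ) :=
        ⟨(-c).toNNReal, by rw [Real.coe_toNNReal _ (by linarith), neg_neg]⟩
      refine ⟨(d • p).swap, (Function.support_const_smul_subset _ _).trans h2,
        (Function.support_const_smul_subset _ _).trans h1, by simp [h3], ?_⟩
      ext g; simp [realDiff, hd]; ring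

/-- The pairs of vectors supported in `H` that `φ` identifies. -/
def kerPairs {C : Type*} [AddCommMonoid C] [Module ℝ≥0 C] (φ : (G → ℝ≥0) →ₗ[ℝ≥0] C) (H : Set G) :
    Set ((G → ℝ≥0) × (G → ℝ≥0)) :=
  {p | support p.1 ⊆ H ∧ support p.2 ⊆ H ∧ φ p.1 = φ p.2}

/-- Finitely generated modules over `ℝ≥0` are finitely presented: the kernel congruence of a
linear map on `ℝ≥0 ^ G` is generated by finitely many pairs. -/
theorem exists_finite_generating_kernel [Finite G] {C : Type*} [AddCommMonoid C] [Module ℝ≥0 C]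
    (φ : (G → ℝ≥0) →ₗ[ℝ≥0] C) :
    ∃ R : Set ((G → ℝ≥0) × (G → ℝ≥0)), R.Finite ∧ (∀ p ∈ R, φ p.1 = φ p.2) ∧
      ∀ (D : Type v) [AddCommMonoid D] [Module ℝ≥0 D] (ψ : (G → ℝ≥0) →ₗ[ℝ≥0] D),
        (∀ p ∈ R, ψ p.1 = ψ p.2) → ∀ x y, φ x = φ y → ψ x = ψ y := by
  have h1 : ∀ H : Set G, ∃ R ⊆ kerPairs φ H, R.Finite ∧
      Submodule.span ℝ (realDiff '' kerPairs φ H) = Submodule.span ℝ (realDiff '' R) := by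
    intro H
    -- The space `G → ℝ` is finite-dimensional, so finitely many differences suffice.
    obtain ⟨s, hs, hspan⟩ := (Submodule.fg_span_iff_fg_span_finset_subset _).1
      (IsNoetherian.noetherian (Submodule.span ℝ (realDiff '' kerPairs φ H)))
    obtain ⟨R, hR, hfin, himg⟩ := Set.exists_subset_image_finite_and.1
      ⟨(s : Set (G → ℝ)), hs, s.finite_toSet, rfl⟩
    exact ⟨R, hR, hfin, by rw [hspan, himg]⟩
  choose R hRsub hRfin hRspan using h1
  -- One representative is kept for each pair of supports that occurs in the kernel.
  have h2 : ∀ FH : Set G × Set G, ∃ S : Set ((G → ℝ≥0) × (G → ℝ≥0)), S.Finite ∧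
      (∀ p ∈ S, φ p.1 = φ p.2) ∧ ∀ x y, support x = FH.1 → support y = FH.2 → φ x = φ y →
        ∃ p ∈ S, support p.1 = FH.1 ∧ support p.2 = FH.2 := by
    intro FH
    by_cases h : ∃ p : (G → ℝ≥0) × (G → ℝ≥0),
        support p.1 = FH.1 ∧ support p.2 = FH.2 ∧ φ p.1 = φ p.2
    · obtain ⟨p, hp1, hp2, hp⟩ := h
      exact ⟨{p}, Set.finite_singleton p, by simpa using hp, fun _ _ _ _ _ => ⟨p, rfl, hp1, hp2⟩⟩
    · exact ⟨∅, Set.finite_empty, by simp, fun x y hx hy hxy => (h ⟨(x, y), hx, hy, hxy⟩).elim⟩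
  choose S hSfin hSφ hS using h2
  refine ⟨(⋃ H, R H) ∪ ⋃ FH, S FH, (Set.finite_iUnion hRfin).union (Set.finite_iUnion hSfin), ?_, ?_⟩
  · rintro p (hp | hp)
    · obtain ⟨H, hp⟩ := Set.mem_iUnion.1 hp
      exact (hRsub H hp).2.2
    · obtain ⟨FH, hp⟩ := Set.mem_iUnion.1 hp
      exact hSφ FH p hp
  intro D _ _ ψ hψ
  have same : ∀ x y, support x = support y → φ x = φ y → ψ x = ψ y := by
    intro x y hs hxy
    have hmem : realDiff (x, y) ∈ Submodule.span ℝ (realDiff '' R (support x)) := by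
      rw [← hRspan]
      exact Submodule.subset_span ⟨(x, y), ⟨subset_rfl, hs.symm.subset, hxy⟩, rfl⟩
    -- Here `x - y = u - w` with `ψ u = ψ w`, and `w` lives on the common support, so both `x` and
    -- `y` absorb a multiple of it.
    obtain ⟨⟨u, w⟩, hu, hw, huw, hdiff⟩ := exists_balanced_of_mem_span ψ
      (fun p hp => ⟨(hRsub _ hp).1, (hRsub _ hp).2.1⟩)
      (fun p hp => hψ p (Or.inl (Set.mem_iUnion.2 ⟨_, hp⟩))) hmem
    have hadd : x + w = y + u := by
      ext g
      have := congrFun hdiff g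
      simp only [realDiff] at this
      simp only [Pi.add_apply, NNReal.coe_add]
      linarith
    have hadd' : ψ x + ψ w = ψ y + ψ w := by
      rw [← map_add, hadd, map_add, huw]
    obtain ⟨ε, hε, hx⟩ := exists_pos_add_smul_of_support_subset hw
    obtain ⟨ε', hε', hy⟩ := exists_pos_add_smul_of_support_subset (hw.trans hs.subset)
    -- Cancellation needs the same multiple of `w` on both sides.
    obtain ⟨x', hx'⟩ := hx (min ε ε') (min_le_left _ _)
    obtain ⟨y', hy'⟩ := hy (min ε ε') (min_le_right _ _)
    exact eq_of_add_eq_add_of_absorbs (lt_min hε hε') (by rw [← map_smul, ← map_add, ← hx'])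
      (by rw [← map_smul, ← map_add, ← hy']) hadd'
  have nested : ∀ x y, support x ⊆ support y → φ x = φ y → ψ x = ψ y := by
    intro x y hs hxy
    -- Replacing `ε • p.1` inside `x` by `ε • p.2` enlarges the support to that of `y` without
    -- changing the values of `φ` and `ψ`.
    obtain ⟨p, hp, hp1, hp2⟩ := hS (support x, support y) x y rfl rfl hxy
    obtain ⟨ε, hε, hx⟩ := exists_pos_add_smul_of_support_subset hp1.subset
    obtain ⟨x', hx'⟩ := hx ε le_rfl
    have hsupp : support (x' + ε • p.2) = support y := by
      have hx's : support x' ⊆ support x := by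
        intro g hg
        rw [Function.mem_support] at hg ⊢
        rw [hx']
        simp [hg]
      ext g
      have h1 : p.2 g ≠ 0 ↔ y g ≠ 0 := Set.ext_iff.1 hp2 g
      have h2 : x' g ≠ 0 → y g ≠ 0 := fun h => hs (hx's h)
      simp only [Function.mem_support, Pi.add_apply, Pi.smul_apply, smul_eq_mul, ne_eq,
        add_eq_zero, mul_eq_zero, hε.ne', false_or]
      tauto
    have hψx : ψ x = ψ (x' + ε • p.2) := by
      conv_lhs => rw [hx']
      rw [map_add, map_add, map_smul, map_smul, hψ p (Or.inr (Set.mem_iUnion.2 ⟨_, hp⟩))]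
    have hφx : φ x = φ (x' + ε • p.2) := by
      conv_lhs => rw [hx']
      rw [map_add, map_add, map_smul, map_smul, hSφ _ p hp]
    rw [hψx]
    exact same _ _ hsupp (hφx.symm.trans hxy)
  intro x y hxy
  -- The midpoint has the same image under `φ`, and its support contains both supports.
  have hm : ∀ a b : G → ℝ≥0, φ a = φ b → φ a = φ ((1 / 2 : ℝ≥0) • (a + b)) := fun a b h => by
    rw [map_smul, map_add, ← h, smul_add, ← add_smul, add_halves, one_smul]
  have hsub : ∀ a b : G → ℝ≥0, support a ⊆ support ((1 / 2 : ℝ≥0) • (a + b)) := by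
    intro a b g hg
    rw [Function.mem_support] at hg ⊢
    simp [hg]
  rw [nested _ _ (hsub x y) (hm x y hxy), add_comm x y]
  exact (nested _ _ (hsub y x) (hm y x hxy.symm)).symm

end Kernel

/-! ### The cone over a convex set as an `ℝ≥0`-module. -/

namespace ConvexSet

open HasMix (mix)

/-- The cone over a convex set: formal positive multiples of its points, together with `0`. -/
inductive Cone (X : Type*) where
  | zero : Cone X
  | point (t : ℝ≥0) (ht : 0 < t) (x : X) : Cone X

theorem mix_one {X : Type*} [ConvexSet X] (x y : X) : mix 1 x y = x := by
  rw [mix_comm, unitInterval.symm_one, mix_zero]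

/-- The proportion `s / (s + t)` as a point of the unit interval. -/
noncomputable def proportion (s t : ℝ≥0) : unitInterval :=
  ⟨(s : ℝ) / (s + t), by positivity, div_le_one_of_le₀ (by simp) (by positivity)⟩

namespace Cone

variable {X : Type*}

theorem point_congr {s t : ℝ≥0} {hs : 0 < s} {ht : 0 < t} {x y : X} (h : s = t) (h' : x = y) :
    point s hs x = point t ht y := by
  subst h h'; rfl

instance : Zero (Cone X) := ⟨zero⟩

theorem zero_eq : (zero : Cone X) = 0 := rfl

open Classical in
noncomputable instance : SMul ℝ≥0 (Cone X) where
  smul c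
    | zero => zero
    | point t ht x => if h : 0 < c then point (c * t) (by positivity) x else zero

theorem smul_point (c : ℝ≥0) (hc : 0 < c) (t : ℝ≥0) (ht : 0 < t) (x : X) :
    c • point t ht x = point (c * t) (by positivity) x := dif_pos hc

protected theorem smul_zero (c : ℝ≥0) : c • (0 : Cone X) = 0 := rfl

protected theorem zero_smul (a : Cone X) : (0 : ℝ≥0) • a = 0 := by
  rcases a with _ | ⟨t, ht, x⟩
  · rfl
  · exact dif_neg (lt_irrefl _)

/-- The embedding of a convex set into its cone. -/
noncomputable def ofPoint (x : X) : Cone X := point 1 one_pos x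

theorem ofPoint_injective : Function.Injective (ofPoint : X → Cone X) := by
  intro x y h
  simpa [ofPoint] using h

theorem smul_ofPoint (t : ℝ≥0) (ht : 0 < t) (x : X) : t • ofPoint x = point t ht x :=
  (smul_point t ht 1 one_pos x).trans (point_congr (mul_one _) rfl)

variable [ConvexSet X]

noncomputable instance : Add (Cone X) where
  add
    | zero, b => b
    | a, zero => a
    | point s hs x, point t _ y => point (s + t) (by positivity) (mix (proportion s t) x y)

theorem point_add_point (s t : ℝ≥0) (hs : 0 < s) (ht : 0 < t) (x y : X) :
    point s hs x + point t ht y = point (s + t) (by positivity) (mix (proportion s t) x y) := rfl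

protected theorem zero_add (a : Cone X) : 0 + a = a := by cases a <;> rfl

protected theorem add_zero (a : Cone X) : a + 0 = a := by cases a <;> rfl

noncomputable instance : AddCommMonoid (Cone X) where
  zero_add := Cone.zero_add
  add_zero := Cone.add_zero
  nsmul := nsmulRec
  add_comm a b := by
    rcases a with _ | ⟨s, hs, x⟩ <;> rcases b with _ | ⟨t, ht, y⟩ <;>
      simp only [zero_eq, Cone.zero_add, Cone.add_zero, point_add_point]
    refine point_congr (add_comm _ _) ?_
    rw [mix_comm]
    congr 1
    ext
    have : (s : ℝ) + t ≠ 0 := by positivity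
    simp only [proportion, unitInterval.coe_symm_eq, add_comm (t : ℝ) s]
    field_simp
    ring
  add_assoc a b c := by
    rcases a with _ | ⟨s, hs, x⟩ <;> rcases b with _ | ⟨t, ht, y⟩ <;>
      rcases c with _ | ⟨u, hu, z⟩ <;>
      simp only [zero_eq, Cone.zero_add, Cone.add_zero, point_add_point]
    refine point_congr (add_assoc _ _ _) ?_
    symm
    have h1 : (s : ℝ) + t ≠ 0 := by positivity
    have h2 : (t : ℝ) + u ≠ 0 := by positivity
    have h3 : (s : ℝ) + t + u ≠ 0 := by positivity
    have h4 : (s : ℝ) + (t + u) ≠ 0 := by positivity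
    apply mix_assoc
    · simp only [proportion, NNReal.coe_add]
      field_simp
      ring
    · simp only [proportion, NNReal.coe_add]
      positivity
    · simp only [proportion, NNReal.coe_add]
      field_simp
      try ring

noncomputable instance : Module ℝ≥0 (Cone X) where
  smul_zero := Cone.smul_zero
  zero_smul := Cone.zero_smul
  one_smul a := by
    rcases a with _ | ⟨t, ht, x⟩
    · rfl
    · rw [smul_point _ one_pos]
      exact point_congr (one_mul _) rfl
  mul_smul c d a := by
    rcases eq_or_ne c 0 with rfl | hc
    · simp only [zero_mul, Cone.zero_smul]
    rcases eq_or_ne d 0 with rfl | hd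
    · simp only [mul_zero, Cone.zero_smul, Cone.smul_zero]
    rcases a with _ | ⟨t, ht, x⟩
    · rfl
    rw [smul_point d (by positivity), smul_point c (by positivity), smul_point _ (by positivity)]
    exact point_congr (mul_assoc _ _ _) rfl
  smul_add c a b := by
    rcases eq_or_ne c 0 with rfl | hc
    · simp only [Cone.zero_smul, add_zero]
    rcases a with _ | ⟨s, hs, x⟩
    · simp only [zero_eq, Cone.smul_zero, zero_add]
    rcases b with _ | ⟨t, ht, y⟩
    · simp only [zero_eq, Cone.smul_zero, add_zero]
    simp only [smul_point c (by positivity : 0 < c), point_add_point]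
    refine point_congr (mul_add _ _ _) ?_
    congr 1
    ext
    simp only [proportion, NNReal.coe_mul]
    rw [← mul_add, mul_div_mul_left _ _ (by positivity)]
  add_smul c d a := by
    rcases eq_or_ne c 0 with rfl | hc
    · simp only [Cone.zero_smul, zero_add]
    rcases eq_or_ne d 0 with rfl | hd
    · simp only [Cone.zero_smul, add_zero]
    rcases a with _ | ⟨t, ht, x⟩
    · rfl
    simp only [smul_point c (by positivity : 0 < c), smul_point d (by positivity : 0 < d),
      smul_point (c + d) (by positivity), point_add_point, mix_self]
    exact point_congr (add_mul _ _ _) rfl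

theorem ofPoint_mix (r : unitInterval) (x y : X) :
    ofPoint (mix r x y) =
      unitInterval.toNNReal r • ofPoint x + unitInterval.toNNReal (unitInterval.symm r) • ofPoint y := by
  -- The endpoints are separate because nonzero cone points carry positive weight.
  rcases eq_or_ne r 0 with rfl | h0
  · simp [mix_zero]
  rcases eq_or_ne r 1 with rfl | h1
  · simp [mix_one]
  have hr : 0 < unitInterval.toNNReal r := unitInterval.pos_iff_ne_zero.2 h0
  have hs : 0 < unitInterval.toNNReal (unitInterval.symm r) := by
    refine unitInterval.pos_iff_ne_zero.2 fun h => h1 ?_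
    simpa using congrArg unitInterval.symm h
  rw [smul_ofPoint _ hr, smul_ofPoint _ hs, point_add_point]
  refine point_congr ?_ ?_
  · ext; simp
  · congr 1
    ext
    simp [proportion]

/-- The linear map from nonnegative combinations of `G` to the cone over `X` which extends
`b : G → X`. -/
noncomputable def combination {G : Type*} [Fintype G] (b : G → X) : (G → ℝ≥0) →ₗ[ℝ≥0] Cone X :=
  Fintype.linearCombination ℝ≥0 fun g => ofPoint (b g)

/-- The total weight of a point of the cone. -/
def weight : Cone X → ℝ≥0
  | zero => 0
  | point t _ _ => t

theorem weight_add (a b : Cone X) : weight (a + b) = weight a + weight b := by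
  rcases a with _ | ⟨s, hs, x⟩
  · rw [zero_eq, zero_add]; exact (zero_add _).symm
  rcases b with _ | ⟨t, ht, y⟩
  · rw [zero_eq, add_zero]; exact (add_zero _).symm
  rfl

theorem weight_smul_ofPoint (c : ℝ≥0) (x : X) : weight (c • ofPoint x) = c := by
  rcases eq_or_ne c 0 with rfl | hc
  · rw [zero_smul]; rfl
  · rw [smul_ofPoint c (by positivity)]; rfl

/-- Consequently, both members of a kernel pair have the same total weight and can be normalized
together. -/
theorem weight_combination {G : Type*} [Fintype G] (b : G → X) (v : G → ℝ≥0) :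
    weight (combination b v) = ∑ g, v g := by
  let w : Cone X →+ ℝ≥0 := ⟨⟨weight, rfl⟩, weight_add⟩
  change w _ = _
  rw [combination, Fintype.linearCombination_apply, map_sum]
  exact Finset.sum_congr rfl fun g _ => weight_smul_ofPoint _ _

end Cone

end ConvexSet

/-! ### Convex terms and presentations of convex sets. -/

/-- Terms over the signature of convex sets with variables from `G`. -/
inductive ConvexTerm (G : Type*) where
  | var : G → ConvexTerm G
  | mix : unitInterval → ConvexTerm G → ConvexTerm G → ConvexTerm G

namespace ConvexTerm

open Convexity (StdSimplex)
open ConvexSet (Cone)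

variable {G : Type*}

/-- The value of a convex term under an assignment of its variables. -/
def eval {X : Type*} [HasMix X] (b : G → X) : ConvexTerm G → X
  | var g => b g
  | mix r c c' => HasMix.mix r (eval b c) (eval b c')

theorem map_eval {X Y : Type*} [HasMix X] [HasMix Y] {f : X → Y} (hf : IsAffine f) (b : G → X)
    (c : ConvexTerm G) : f (eval b c) = eval (f ∘ b) c := by
  induction c with
  | var g => rfl
  | mix r c c' ih ih' => rw [eval, eval, hf r, ih, ih']

/-- The distribution denoted by a convex term. -/
noncomputable def distribution (c : ConvexTerm G) : StdSimplex ℝ G := eval StdSimplex.single c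

theorem exists_distribution_eq (d : StdSimplex ℝ G) : ∃ c : ConvexTerm G, c.distribution = d := by
  classical
  induction h : d.weights.support.card using Nat.strong_induction_on generalizing d with
  | _ n ih =>
  obtain ⟨x, hx⟩ := d.support_weights_nonempty
  have hs : ∃ y ∈ ({x} : Set G), d.weights y ≠ 0 := ⟨x, rfl, Finsupp.mem_support_iff.1 hx⟩
  by_cases hs' : ∃ y ∈ ({x} : Set G)ᶜ, d.weights y ≠ 0
  -- Split off the point `x`; the normalized remainder has smaller support.
  · obtain ⟨c, hc⟩ := ih (d.restrict {x}ᶜ hs').weights.support.card (by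
      rw [StdSimplex.support_weights_restrict, ← h]
      exact Finset.card_lt_card (Finset.filter_ssubset.2 ⟨x, hx, by simp⟩)) _ rfl
    have hd := StdSimplex.convexCombPair_restrict_restrict_compl d {x} hs hs'
    have h0 : 0 ≤ (d.weights.filter (· ∈ ({x} : Set G))).sum fun _ k => k :=
      Finsupp.sum_nonneg fun y _ => by
        rw [Finsupp.filter_apply]; split_ifs <;> simp
    have h0' : 0 ≤ (d.weights.filter (· ∉ ({x} : Set G))).sum fun _ k => k :=
      Finsupp.sum_nonneg fun y _ => by
        rw [Finsupp.filter_apply]; split_ifs <;> simp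
    have h1 : ((d.weights.filter (· ∈ ({x} : Set G))).sum fun _ k => k) +
        ((d.weights.filter (· ∉ ({x} : Set G))).sum fun _ k => k) = 1 := by simp
    refine ⟨mix ⟨_, h0, by linarith⟩ (var x) c, ?_⟩
    rw [distribution] at hc ⊢
    conv_rhs => rw [← hd]
    ext g
    simp only [eval, hc, StdSimplex_mix_weights, StdSimplex.restrict_singleton]
    simp only [StdSimplex.weights_convexCombPair, Finsupp.add_apply, Finsupp.smul_apply,
      smul_eq_mul, ← h1]
    ring
  · refine ⟨var x, ?_⟩
    push Not at hs'
    refine (StdSimplex.support_weights_eq_singleton.1 ?_).symm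
    ext y
    by_cases hy : y = x
    · subst hy; simpa using hx
    · simpa [hy] using hs' y hy

/-- The coefficient vector of a convex term. -/
noncomputable def coeff (c : ConvexTerm G) : G → ℝ≥0 :=
  fun g => (c.distribution.weights g).toNNReal

theorem coe_coeff (c : ConvexTerm G) (g : G) : (c.coeff g : ℝ) = c.distribution.weights g :=
  Real.coe_toNNReal _ (c.distribution.weights_nonneg g)

theorem coeff_var [DecidableEq G] (g : G) : coeff (var g) = Pi.single g 1 := by
  ext x
  rw [coe_coeff]
  simp only [distribution, eval, Convexity.StdSimplex.weights_single, Finsupp.single_apply,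
    Pi.single_apply, eq_comm (a := x)]
  split_ifs <;> simp

theorem coeff_mix (r : unitInterval) (c c' : ConvexTerm G) :
    coeff (mix r c c') = unitInterval.toNNReal r • coeff c +
      unitInterval.toNNReal (unitInterval.symm r) • coeff c' := by
  ext x
  simp [coe_coeff, distribution, eval, StdSimplex_mix_weights]

/-- Inside the cone, a convex term acts through its coefficient vector alone, so equations of terms
become kernel pairs of `Cone.combination b`. -/
theorem ofPoint_eval [Fintype G] {X : Type*} [ConvexSet X] (b : G → X) (c : ConvexTerm G) :
    Cone.ofPoint (eval b c) = Cone.combination b c.coeff := by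
  classical
  induction c with
  | var g => simp [coeff_var, Cone.combination, eval, Fintype.linearCombination_apply_single]
  | mix r c c' ih ih' =>
    rw [coeff_mix, map_add, map_smul, map_smul, ← ih, ← ih', eval, Cone.ofPoint_mix]

theorem exists_coeff_eq [Fintype G] (v : G → ℝ≥0) (hv : ∑ g, v g = 1) :
    ∃ c : ConvexTerm G, c.coeff = v := by
  let d : StdSimplex ℝ G :=
    { weights := Finsupp.equivFunOnFinite.symm fun g => (v g : ℝ)
      nonneg := fun g => by simp
      total := by
        rw [Finsupp.sum_fintype _ _ (fun _ => rfl)]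
        simpa using congrArg ((↑) : ℝ≥0 → ℝ) hv }
  obtain ⟨c, hc⟩ := exists_distribution_eq d
  refine ⟨c, ?_⟩
  ext g
  simp [coe_coeff, hc, d]

/-- Finitely generated convex sets are finitely presented: the equations between convex terms
which hold for `m : G → X` follow from finitely many of them. -/
theorem exists_finite_relations [Fintype G] {X : Type*} [ConvexSet X] (m : G → X) :
    ∃ R : Set (ConvexTerm G × ConvexTerm G), R.Finite ∧ (∀ p ∈ R, eval m p.1 = eval m p.2) ∧
      ∀ (B : Type v) [ConvexSet B] (b : G → B), (∀ p ∈ R, eval b p.1 = eval b p.2) →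
        ∀ c c', eval m c = eval m c' → eval b c = eval b c' := by
  obtain ⟨R, hfin, hR, hgen⟩ := exists_finite_generating_kernel.{v} (Cone.combination m)
  -- Pairs of weight zero are `(0, 0)` and can be dropped; all others are rescaled to weight one.
  have hex : ∀ p : {p ∈ R | ∑ g, p.1 g ≠ 0}, ∃ (t : ℝ≥0) (c c' : ConvexTerm G), t ≠ 0 ∧
      p.1.1 = t • c.coeff ∧ p.1.2 = t • c'.coeff := by
    rintro ⟨p, hp, h0⟩
    have hw : ∑ g, p.1 g = ∑ g, p.2 g := by
      rw [← Cone.weight_combination m, ← Cone.weight_combination m, hR p hp]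
    have normalize : ∀ v : G → ℝ≥0, ∑ g, v g = ∑ g, p.1 g →
        ∃ c : ConvexTerm G, v = (∑ g, p.1 g) • c.coeff := by
      intro v hv
      obtain ⟨c, hc⟩ := exists_coeff_eq ((∑ g, p.1 g)⁻¹ • v) (by
        simp only [Pi.smul_apply, smul_eq_mul, ← Finset.mul_sum, hv, inv_mul_cancel₀ h0])
      exact ⟨c, by rw [hc, smul_inv_smul₀ h0]⟩
    obtain ⟨c, hc⟩ := normalize p.1 rfl
    obtain ⟨c', hc'⟩ := normalize p.2 hw.symm
    exact ⟨_, c, c', h0, hc, hc'⟩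
  choose t c c' ht hc hc' using hex
  have : Finite {p ∈ R | ∑ g, p.1 g ≠ 0} := (hfin.subset (Set.sep_subset _ _)).to_subtype
  refine ⟨Set.range fun p => (c p, c' p), Set.finite_range _, ?_, ?_⟩
  · rintro _ ⟨p, rfl⟩
    apply Cone.ofPoint_injective
    have h := hR p.1 p.2.1
    rw [hc, hc', map_smul, map_smul] at h
    simpa [ofPoint_eval, smul_smul, inv_mul_cancel₀ (ht p)] using congrArg ((t p)⁻¹ • ·) h
  · intro B _ b hb a a' h
    apply Cone.ofPoint_injective
    rw [ofPoint_eval, ofPoint_eval]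
    refine hgen _ (Cone.combination b) (fun p hp => ?_) _ _ (by
      rw [← ofPoint_eval, ← ofPoint_eval, h])
    by_cases h0 : ∑ g, p.1 g = 0
    · have hw : ∑ g, p.2 g = 0 := by
        rw [← h0, ← Cone.weight_combination m, ← Cone.weight_combination m, hR p hp]
      have e1 : p.1 = 0 := funext fun g => Finset.sum_eq_zero_iff.1 h0 g (Finset.mem_univ g)
      have e2 : p.2 = 0 := funext fun g => Finset.sum_eq_zero_iff.1 hw g (Finset.mem_univ g)
      rw [e1, e2]
    · have h1 := hb _ ⟨⟨p, hp, h0⟩, rfl⟩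
      have e1 := hc ⟨p, hp, h0⟩
      have e2 := hc' ⟨p, hp, h0⟩
      simp only at e1 e2 h1
      rw [e1, e2, map_smul, map_smul, ← ofPoint_eval, ← ofPoint_eval, h1]

/-- A convex term as a term over the signature of convex monoids. -/
def toTerm : ConvexTerm G → ConvexMonoid.Term G
  | var g => .var g
  | mix r c c' => .mix r (toTerm c) (toTerm c')

end ConvexTerm

/-! ### Reduction of monoid terms to convex terms. -/

namespace ConvexMonoid

open ConvexTerm (eval toTerm)

/-- The value of a term in a convex monoid under an assignment of its variables. -/
def Term.eval {G M : Type*} [ConvexMonoid M] (m : G → M) : Term G → M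
  | .var g => m g
  | .one => 1
  | .mul s t => Term.eval m s * Term.eval m t
  | .mix r s t => HasMix.mix r (Term.eval m s) (Term.eval m t)

theorem Term.isMorphism_eval {G M : Type*} [ConvexMonoid M] (m : G → M) :
    IsMorphism (Term.eval m) :=
  ⟨rfl, fun _ _ => rfl, fun _ _ _ => rfl⟩

theorem IsMorphism.map_toTerm {G B : Type*} [ConvexMonoid B] {h : Term G → B} (hh : IsMorphism h)
    (c : ConvexTerm G) : h (toTerm c) = eval (fun g => h (.var g)) c := by
  induction c with
  | var g => rfl
  | mix r c c' ih ih' => rw [eval, ← ih, ← ih']; exact hh.map_mix r _ _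

/-- If products of generators are given by convex terms in two convex monoids simultaneously, then
so are products of convex terms. -/
theorem exists_eval_mul {G M B : Type*} [ConvexMonoid M] [ConvexMonoid B] {m : G → M} {b : G → B}
    (hvar : ∀ g g', ∃ c, m g * m g' = eval m c ∧ b g * b g' = eval b c) (c c' : ConvexTerm G) :
    ∃ c'', eval m c * eval m c' = eval m c'' ∧ eval b c * eval b c' = eval b c'' := by
  induction c with
  | mix r c₁ c₂ ih₁ ih₂ =>
    obtain ⟨d₁, hm₁, hb₁⟩ := ih₁
    obtain ⟨d₂, hm₂, hb₂⟩ := ih₂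
    exact ⟨.mix r d₁ d₂, by simp only [eval, mix_mul, hm₁, hm₂],
      by simp only [eval, mix_mul, hb₁, hb₂]⟩
  | var g =>
    induction c' with
    | mix r c₁ c₂ ih₁ ih₂ =>
      obtain ⟨d₁, hm₁, hb₁⟩ := ih₁
      obtain ⟨d₂, hm₂, hb₂⟩ := ih₂
      exact ⟨.mix r d₁ d₂, by simp only [eval, mul_mix] at *; rw [hm₁, hm₂],
        by simp only [eval, mul_mix] at *; rw [hb₁, hb₂]⟩
    | var g' => exact hvar g g'

/-- If the unit and products of generators are given by convex terms in two convex monoids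
simultaneously, then so are the values of all terms. -/
theorem exists_convexTerm {G M B : Type*} [ConvexMonoid M] [ConvexMonoid B]
    {q : Term G → M} {h : Term G → B} (hq : IsMorphism q) (hh : IsMorphism h)
    (hone : ∃ c, q 1 = q (toTerm c) ∧ h 1 = h (toTerm c))
    (hvar : ∀ g g', ∃ c, q (Term.var g * Term.var g') = q (toTerm c) ∧
      h (Term.var g * Term.var g') = h (toTerm c)) (t : Term G) :
    ∃ c, q t = q (toTerm c) ∧ h t = h (toTerm c) := by
  induction t with
  | var g => exact ⟨.var g, rfl, rfl⟩
  | one => exact hone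
  | mul s t ihs iht =>
    obtain ⟨c, hqc, hhc⟩ := ihs
    obtain ⟨c', hqc', hhc'⟩ := iht
    obtain ⟨c'', h1, h2⟩ := exists_eval_mul (m := fun g => q (.var g)) (b := fun g => h (.var g))
      (fun g g' => by
        simpa only [hq.map_mul, hh.map_mul, hq.map_toTerm, hh.map_toTerm] using hvar g g') c c'
    refine ⟨c'', ?_, ?_⟩
    · rw [hq.map_toTerm, ← h1, ← hq.map_toTerm, ← hq.map_toTerm, ← hqc, ← hqc']
      exact hq.map_mul s t
    · rw [hh.map_toTerm, ← h2, ← hh.map_toTerm, ← hh.map_toTerm, ← hhc, ← hhc']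
      exact hh.map_mul s t
  | mix r s t ihs iht =>
    obtain ⟨c, hqc, hhc⟩ := ihs
    obtain ⟨c', hqc', hhc'⟩ := iht
    refine ⟨.mix r c c', ?_, ?_⟩
    · exact (hq.map_mix r s t).trans (by rw [hqc, hqc']; exact (hq.map_mix r _ _).symm)
    · exact (hh.map_mix r s t).trans (by rw [hhc, hhc']; exact (hh.map_mix r _ _).symm)

theorem exists_factorization {A M B : Type*} [One A] [Mul A] [HasMix A] [One M] [Mul M] [HasMix M]
    [One B] [Mul B] [HasMix B] {q : A → M} {h : A → B} (hq : IsMorphism q) (hh : IsMorphism h)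
    (hsurj : Function.Surjective q) (hker : ∀ s t, q s = q t → h s = h t) :
    ∃ k : M → B, IsMorphism k ∧ h = k ∘ q := by
  have hk : ∀ s, h (Function.surjInv hsurj (q s)) = h s :=
    fun s => hker _ _ (Function.surjInv_eq hsurj _)
  refine ⟨fun x => h (Function.surjInv hsurj x), ⟨?_, ?_, ?_⟩, funext fun s => (hk s).symm⟩
  · rw [← hq.map_one, hk, hh.map_one]
  · refine hsurj.forall₂.2 fun s t => ?_
    rw [← hq.map_mul, hk, hk, hk, hh.map_mul]
  · refine fun r => hsurj.forall₂.2 fun s t => ?_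
    rw [← hq.map_mix, hk, hk, hk, hh.map_mix]

end ConvexMonoid

theorem mainTheorem8 (M : Type u) [ConvexMonoid M]
    (hM : ConvexMonoid.IsFgCarried M) :
    ConvexMonoid.IsFinitelyPresentable.{v, u} M := by
  open ConvexMonoid ConvexTerm in
  obtain ⟨G, hG, s, hs, hsurj⟩ := hM
  have := Fintype.ofFinite G
  let m : G → M := s ∘ Convexity.StdSimplex.single
  have hq := Term.isMorphism_eval m
  have hqc : ∀ c, Term.eval m (toTerm c) = ConvexTerm.eval m c := hq.map_toTerm
  have hcover : ∀ x : M, ∃ c : ConvexTerm G, Term.eval m (toTerm c) = x := by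
    intro x
    obtain ⟨d, rfl⟩ := hsurj x
    obtain ⟨c, rfl⟩ := exists_distribution_eq d
    exact ⟨c, by rw [hqc, distribution, map_eval hs]⟩
  obtain ⟨R, hfin, hR, hgen⟩ := exists_finite_relations.{v} m
  obtain ⟨e, he⟩ := hcover 1
  -- A multiplication table: a convex term for each product of two generators.
  choose μ hμ using fun p : G × G => hcover (m p.1 * m p.2)
  refine ⟨G, (fun p => (toTerm p.1, toTerm p.2)) '' R ∪ {(1, toTerm e)} ∪
    Set.range (fun p : G × G => (Term.var p.1 * Term.var p.2, toTerm (μ p))), Term.eval m, hG,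
    ((hfin.image _).union (Set.finite_singleton _)).union (Set.finite_range _), hq,
    fun x => (hcover x).imp' toTerm fun _ => id, ?_, ?_⟩
  · rintro _ ((⟨p, hp, rfl⟩ | rfl) | ⟨p, rfl⟩)
    · simpa only [hqc] using hR p hp
    · exact he.symm
    · exact (hμ p).symm
  · intro B _ h hh hrel
    -- The reduced term is the same for `M` and `B`, so an equality in `M` becomes an equation of
    -- convex terms that transfers to `B`.
    have hred := exists_convexTerm hq hh ⟨e, he.symm, hrel _ (Or.inl (Or.inr rfl))⟩
      fun g g' => ⟨μ (g, g'), (hμ (g, g')).symm, hrel _ (Or.inr ⟨(g, g'), rfl⟩)⟩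
    refine exists_factorization hq hh (fun x => (hcover x).imp' toTerm fun _ => id)
      fun t t' htt' => ?_
    obtain ⟨c, hc, hc'⟩ := hred t
    obtain ⟨d, hd, hd'⟩ := hred t'
    rw [hc', hd', hh.map_toTerm, hh.map_toTerm]
    refine hgen B _ (fun p hp => ?_) c d (by rw [← hqc, ← hqc, ← hc, ← hd, htt'])
    rw [← hh.map_toTerm, ← hh.map_toTerm]
    exact hrel _ (Or.inl (Or.inl ⟨p, hp, rfl⟩))
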